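/- All graphs are finite and simple. Let $\mathcal{G}_2$ be the family of graphs that have girth $5$ (that is, whose shortest cycle has length exactly $5$) and have no odd hole of length at least $7$, where a hole is an induced cycle of length at least $4$. A graph is $3$-connected if it has at least $4$ vertices and remains connected after the deletion of any set of at most two vertices. A $3$-cutset of $G$ is a set $S$ of three vertices such that $G-S$ is disconnected; it is stable if no two of its vertices are adjacent in $G$. Let $\theta^+$ be the graph obtained from the Petersen graph by deleting two adjacent vertices. Theorem. Let $G$ be a $3$-connected graph in $\mathcal{G}_2$ in which every $3$-cutset is stable. If $G$ is not isomorphic to the Petersen graph, then $G$ does not induce $\theta^+$; that is, no induced subgraph of $G$ is isomorphic to $\theta^+$. -/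

import Mathlib

namespace OddHoles

/-- The closed walk `c` is a hole of `G`: an induced (chordless) cycle of length at least four. -/
structure IsHole {V : Type*} {G : SimpleGraph V} {u : V} (c : G.Walk u u) : Prop where
  isCycle : c.IsCycle
  isChordless : c.IsChordless
  four_le_length : 4 ≤ c.length

/-- The family of graphs of girth exactly `2 * l + 1` that have no odd hole of length at
least `2 * l + 3`. The extended girth is infinite for a graph without cycles. -/
structure MemG {V : Type*} (l : ℕ) (G : SimpleGraph V) : Prop where
  egirth_eq : G.egirth = ((2 * l + 1 : ℕ) : ℕ∞)
  no_long_odd_hole : ¬ ∃ (u : V) (c : G.Walk u u),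
    IsHole c ∧ Odd c.length ∧ 2 * l + 3 ≤ c.length

/-- `G` is `k`-connected: it has more than `k` vertices, and deleting fewer than `k` vertices
always leaves a connected graph. -/
def IsKConnected {V : Type*} (k : ℕ) (G : SimpleGraph V) : Prop :=
  (k : ℕ∞) < ENat.card V ∧
    ∀ S : Finset V, S.card < k → (G.induce ((S : Set V)ᶜ)).Connected

/-- `S` is a cutset of `G`: deleting `S` leaves two vertices not joined by a path. -/
def IsCutset {V : Type*} (G : SimpleGraph V) (S : Finset V) : Prop :=
  ¬ (G.induce ((S : Set V)ᶜ)).Preconnected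

/-- Adjacency of the Petersen graph, with outer vertices `u i = Sum.inl i` and inner vertices
`v i = Sum.inr i` for `i` modulo 5; its edges are `u i u (i+1)`, `v i v (i+2)` and `u i v i`. -/
def petersenAdj : ZMod 5 ⊕ ZMod 5 → ZMod 5 ⊕ ZMod 5 → Prop
  | Sum.inl i, Sum.inl j => j = i + 1 ∨ i = j + 1
  | Sum.inr i, Sum.inr j => j = i + 2 ∨ i = j + 2
  | Sum.inl i, Sum.inr j => i = j
  | Sum.inr i, Sum.inl j => i = j

/-- The Petersen graph. -/
def petersen : SimpleGraph (ZMod 5 ⊕ ZMod 5) where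
  Adj := petersenAdj
  symm := ⟨by
    rintro (i | i) (j | j) h
    · exact Or.symm h
    · exact Eq.symm h
    · exact Eq.symm h
    · exact Or.symm h⟩
  loopless := ⟨by
    rintro (i | i) h
    · revert i; simp only [petersenAdj]; decide
    · revert i; simp only [petersenAdj]; decide⟩

/-- The graph `θ⁺`: the Petersen graph with the two adjacent vertices `u 0` and `u 1` deleted.
(The Petersen graph is edge-transitive, so the choice of the edge is immaterial.) -/
def thetaPlus : SimpleGraph ↥({Sum.inl 0, Sum.inl 1}ᶜ : Set (ZMod 5 ⊕ ZMod 5)) :=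
  petersen.induce ({Sum.inl 0, Sum.inl 1}ᶜ : Set (ZMod 5 ⊕ ZMod 5))

end OddHoles

/-! Consider an induced copy of a small graph `K` on which no outside vertex has two neighbours. The
engine is a parity argument. A shortest outside induced path whose attachments violate a prescribed
pattern has an attachment x seen only by its first vertex and another, y, seen only by its last, so
it gives an induced path from x to y of length at least three. If `K` has induced paths from x to y
of lengths three and four avoiding the other attachments, one of them closes an odd hole of length
at least seven. So paths, and hence components, outside `K` have restricted attachments
(`pathAttach_of_isDetourFamily`, `compAttach_of_isDetourFamily`).

For the Petersen graph, with at most an edge or a vertex removed, at most two attachments survive,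
and 3-connectivity makes `K` all of `G`. The full Petersen graph is excluded by hypothesis; the
other two have vertices of degree two. An outside vertex with two neighbours on θ⁺ would create the
Petersen graph minus a vertex, so θ⁺ is singly attached. Fewer than three attachments, or three
containing an edge, contradict the cutset hypotheses, which leaves four 4-sets: a chord together
with one neighbour of each end, on the same side. Each of the four vertices of degree two needs an
outside neighbour, which forces components on both sides of one chord
(`not_singleAttached_octagon`); these close an odd hole (`not_opposite_compAttach`). -/

namespace OddHoles

open SimpleGraph

variable {V : Type*} {G : SimpleGraph V} {n : ℕ} {K : SimpleGraph (Fin n)}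

/-! ### Induced paths and odd holes. -/

/-- The vertices `p 0, …, p k` are distinct and induce a path of length `k` in `G`. -/
structure IsIndPath (G : SimpleGraph V) (p : ℕ → V) (k : ℕ) : Prop where
  inj : ∀ i ≤ k, ∀ j ≤ k, p i = p j → i = j
  adj : ∀ i ≤ k, ∀ j ≤ k, G.Adj (p i) (p j) ↔ (j = i + 1 ∨ i = j + 1)

theorem mk_getVert_mem_edges {u v : V} (p : G.Walk u v) {m : ℕ} (hm : m < p.length) :
    s(p.getVert m, p.getVert (m + 1)) ∈ p.edges := by
  induction p generalizing m with
  | nil => simp at hm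
  | cons h q ih =>
    cases m with
    | zero => simp
    | succ m =>
      simp only [Walk.getVert_cons_succ, Walk.edges_cons, List.mem_cons]
      exact Or.inr (ih (by simpa using hm))

theorem mem_edges_cycle {n : ℕ} {a b : Fin (n + 3)} (h : (cycleGraph (n + 3)).Adj a b) :
    s(a, b) ∈ (cycleGraph.cycle n).edges := by
  wlog hab : a < b generalizing a b
  · rw [Sym2.eq_swap]
    exact this h.symm (lt_of_le_of_ne (not_lt.mp hab) h.ne')
  have key : ∀ m < n + 3, s((cycleGraph.cycle n).getVert m, (cycleGraph.cycle n).getVert (m + 1))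
      ∈ (cycleGraph.cycle n).edges :=
    fun m hm => mk_getVert_mem_edges _ (by simpa [cycleGraph.length_cycle] using hm)
  have ha := a.2
  have hb := b.2
  have hab' : a.val < b.val := hab
  rw [cycleGraph_adj'] at h
  have hcase : b.val = a.val + 1 ∨ (a.val = 0 ∧ b.val = n + 2) := by
    rcases h with h | h
    · rw [Fin.coe_sub_iff_lt.mpr hab] at h; omega
    · rw [Fin.sub_val_of_le hab.le] at h; omega
  rcases hcase with hc | ⟨h0, h1⟩
  -- The standard cycle runs through the residues downwards, so b is reached at time n + 3 - b and a
  -- = b - 1 comes next.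
  · have := key (n + 3 - b.val) (by omega)
    rw [cycleGraph.getVert_cycle (by omega), cycleGraph.getVert_cycle (by omega),
      Sym2.eq_swap] at this
    convert this using 2 <;> apply Fin.ext <;> dsimp only
    · rw [Nat.mod_eq_of_lt (by omega)]; omega
    · rw [Nat.mod_eq_of_lt (by omega)]; omega
  · have := key 0 (by omega)
    rw [cycleGraph.getVert_cycle (by omega), cycleGraph.getVert_cycle (by omega)] at this
    convert this using 2 <;> apply Fin.ext <;> dsimp only
    · rw [Nat.sub_zero, Nat.mod_self, h0]
    · rw [Nat.mod_eq_of_lt (by omega)]; omega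

theorem MemG.not_odd_cycle (hG : MemG 2 G) {n : ℕ} (hn : Odd n) (h7 : 7 ≤ n) (h : ℕ → V)
    (hinj : ∀ i < n, ∀ j < n, h i = h j → i = j)
    (hadj : ∀ i < n, ∀ j < n, i < j → (G.Adj (h i) (h j) ↔ (j = i + 1 ∨ (i = 0 ∧ j + 1 = n)))) :
    False := by
  obtain ⟨m, rfl⟩ : ∃ m, n = m + 3 := ⟨n - 3, by omega⟩
  have hlt : ∀ a b : Fin (m + 3), a < b →
      (G.Adj (h a) (h b) ↔ (cycleGraph (m + 3)).Adj a b) := by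
    intro a b hab
    have hab' : a.val < b.val := hab
    rw [hadj a a.2 b b.2 hab, cycleGraph_adj', Fin.coe_sub_iff_lt.mpr hab,
      Fin.sub_val_of_le hab.le]
    have := b.2
    omega
  let e : cycleGraph (m + 3) ↪g G :=
    { toFun := fun a => h a
      inj' := fun a b hab => Fin.ext (hinj a a.2 b b.2 hab)
      map_rel_iff' := by
        intro a b
        change G.Adj (h a) (h b) ↔ _
        rcases lt_trichotomy a b with hab | rfl | hab
        · exact hlt a b hab
        · simp
        · rw [G.adj_comm, SimpleGraph.adj_comm (cycleGraph (m + 3))]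
          exact hlt b a hab }
  refine hG.no_long_odd_hole ⟨_, (cycleGraph.cycle m).map e.toHom, ⟨?_, ?_, ?_⟩, ?_, ?_⟩
  · exact (Walk.isCycle_map_iff_of_injective e.injective).mpr cycleGraph.isCycle_cycle
  · rw [Walk.isChordless_iff_forall_mem_edges]
    intro u v hu hv huv
    rw [Walk.support_map, List.mem_map] at hu hv
    obtain ⟨a, -, rfl⟩ := hu
    obtain ⟨b, -, rfl⟩ := hv
    rw [Walk.edges_map, List.mem_map]
    exact ⟨s(a, b), mem_edges_cycle (e.map_rel_iff.mp huv), rfl⟩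
  · simp only [Walk.length_map, cycleGraph.length_cycle]; omega
  · simpa [cycleGraph.length_cycle] using hn
  · simpa [cycleGraph.length_cycle] using h7

/-- Two induced paths with common ends and no contact between their interiors close up to an induced
cycle. -/
theorem MemG.not_odd_theta (hG : MemG 2 G) {f g : ℕ → V} {m n : ℕ} (hf : IsIndPath G f m)
    (hg : IsIndPath G g n) (h0 : f 0 = g 0) (h1 : f m = g n) (hm : 2 ≤ m) (hn : 2 ≤ n)
    (hsep : ∀ i j, 0 < i → i < m → 0 < j → j < n → f i ≠ g j ∧ ¬ G.Adj (f i) (g j))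
    (hodd : Odd (m + n)) (h7 : 7 ≤ m + n) : False := by
  -- The cycle follows `f` forwards and returns along `g` backwards.
  refine hG.not_odd_cycle hodd h7 (fun t => if t ≤ m then f t else g (m + n - t)) ?_ ?_
  · intro i hi j hj hij
    beta_reduce at hij
    split_ifs at hij with h2 h3 h3
    · exact hf.inj i h2 j h3 hij
    · rcases Nat.eq_zero_or_pos i with rfl | hi0
      · rw [h0] at hij
        have := hg.inj _ (by omega) _ (by omega) hij
        omega
      · rcases h2.eq_or_lt with rfl | h2
        · rw [h1] at hij
          have := hg.inj _ (by omega) _ (by omega) hij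
          omega
        · exact absurd hij (hsep i _ hi0 h2 (by omega) (by omega)).1
    · rcases Nat.eq_zero_or_pos j with rfl | hj0
      · rw [h0] at hij
        have := hg.inj _ (by omega) _ (by omega) hij
        omega
      · rcases h3.eq_or_lt with rfl | h3
        · rw [h1] at hij
          have := hg.inj _ (by omega) _ (by omega) hij
          omega
        · exact absurd hij.symm (hsep j _ hj0 h3 (by omega) (by omega)).1
    · have := hg.inj _ (by omega) _ (by omega) hij
      omega
  · intro i hi j hj hlt
    split_ifs with h2 h3 h3
    · rw [hf.adj i h2 j h3]; omega
    · rcases Nat.eq_zero_or_pos i with rfl | hi0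
      · rw [h0, hg.adj _ (by omega) _ (by omega)]; omega
      · rcases h2.eq_or_lt with rfl | h2
        · rw [h1, hg.adj _ (by omega) _ (by omega)]; omega
        · have := (hsep i (m + n - j) hi0 h2 (by omega) (by omega)).2
          simp only [this, false_iff]; omega
    · omega
    · rw [hg.adj _ (by omega) _ (by omega)]; omega

theorem IsIndPath.append {f g : ℕ → V} {m n : ℕ} (hf : IsIndPath G f m) (hg : IsIndPath G g n)
    (h : f m = g 0)
    (hsep : ∀ i j, i < m → 0 < j → j ≤ n → f i ≠ g j ∧ ¬ G.Adj (f i) (g j)) :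
    IsIndPath G (fun t => if t ≤ m then f t else g (t - m)) (m + n) := by
  constructor
  · intro i hi j hj hij
    beta_reduce at hij
    split_ifs at hij with h2 h3 h3
    · exact hf.inj i h2 j h3 hij
    · rcases h2.eq_or_lt with rfl | h2
      · rw [h] at hij
        have := hg.inj _ (by omega) _ (by omega) hij
        omega
      · exact absurd hij (hsep i _ h2 (by omega) (by omega)).1
    · rcases h3.eq_or_lt with rfl | h3
      · rw [h] at hij
        have := hg.inj _ (by omega) _ (by omega) hij
        omega
      · exact absurd hij.symm (hsep j _ h3 (by omega) (by omega)).1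
    · have := hg.inj _ (by omega) _ (by omega) hij
      omega
  · intro i hi j hj
    split_ifs with h2 h3 h3
    · exact hf.adj i h2 j h3
    · rcases h2.eq_or_lt with rfl | h2
      · rw [h, hg.adj _ (by omega) _ (by omega)]; omega
      · have := (hsep i (j - m) h2 (by omega) (by omega)).2
        simp only [this, false_iff]; omega
    · rcases h3.eq_or_lt with rfl | h3
      · rw [h, hg.adj _ (by omega) _ (by omega)]; omega
      · have := (hsep j (i - m) h3 (by omega) (by omega)).2
        rw [G.adj_comm]
        simp only [this, false_iff]; omega
    · rw [hg.adj _ (by omega) _ (by omega)]; omega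

theorem IsIndPath.shift {f : ℕ → V} {m : ℕ} (hf : IsIndPath G f (m + 1)) :
    IsIndPath G (fun t => f (t + 1)) m := by
  constructor
  · intro i hi j hj hij
    have := hf.inj _ (by omega) _ (by omega) hij
    omega
  · intro i hi j hj
    rw [hf.adj _ (by omega) _ (by omega)]; omega

theorem IsIndPath.mono {f : ℕ → V} {m n : ℕ} (hf : IsIndPath G f m) (h : n ≤ m) :
    IsIndPath G f n :=
  ⟨fun i hi j hj => hf.inj i (hi.trans h) j (hj.trans h),
    fun i hi j hj => hf.adj i (hi.trans h) j (hj.trans h)⟩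

theorem IsIndPath.map {W : Type*} {K : SimpleGraph W} {f : ℕ → W} {m : ℕ} (hf : IsIndPath K f m)
    (φ : K ↪g G) : IsIndPath G (fun t => φ (f t)) m :=
  ⟨fun i hi j hj h => hf.inj i hi j hj (φ.injective h),
    fun i hi j hj => φ.map_rel_iff.trans (hf.adj i hi j hj)⟩

/-- Turns a concrete induced path into a finite check suitable for `decide`; the default `d` is
never read within the bounds. -/
theorem isIndPath_of_list (l : List V) (d : V)
    (h : ∀ i < l.length, ∀ j < l.length, i < j →
      l.getD i d ≠ l.getD j d ∧ (G.Adj (l.getD i d) (l.getD j d) ↔ j = i + 1)) :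
    IsIndPath G (fun t => l.getD t d) (l.length - 1) := by
  rcases l with _ | ⟨a, l⟩
  · constructor <;> simp
  simp only [List.length_cons, Nat.add_sub_cancel] at h ⊢
  constructor
  · intro i hi j hj hij
    rcases lt_trichotomy i j with hlt | rfl | hlt
    · exact absurd hij (h i (by omega) j (by omega) hlt).1
    · rfl
    · exact absurd hij.symm (h j (by omega) i (by omega) hlt).1
  · intro i hi j hj
    rcases lt_trichotomy i j with hlt | rfl | hlt
    · rw [(h i (by omega) j (by omega) hlt).2]; omega
    · simp
    · rw [G.adj_comm, (h j (by omega) i (by omega) hlt).2]; omega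

/-- A shortest walk is induced: a repetition or a chord would shorten it. -/
theorem exists_isIndPath_of_reachable {O : Set V} {u w : O} (h : (G.induce O).Reachable u w) :
    ∃ (k : ℕ) (p : ℕ → V), IsIndPath G p k ∧ p 0 = u ∧ p k = w ∧
      ∀ i ≤ k, ∃ hi : p i ∈ O, (G.induce O).Reachable u ⟨p i, hi⟩ := by
  obtain ⟨q, hq⟩ := h.exists_walk_length_eq_dist
  have key : ∀ i j, i < j → j ≤ q.length → q.getVert i ≠ q.getVert j ∧
      (G.Adj (q.getVert i : V) (q.getVert j) ↔ j = i + 1) := by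
    intro i j hij hj
    have hlen : (q.drop j).length = q.length - j := by simp
    have hlen' : (q.take i).length = i := by simp; omega
    refine ⟨fun he => ?_, fun ha => ?_, ?_⟩
    · have := dist_le ((q.take i).append ((q.drop j).copy he.symm rfl))
      simp only [Walk.length_append, Walk.length_copy] at this
      omega
    · by_contra hne
      have := dist_le ((q.take i).append (Walk.cons (show (G.induce O).Adj _ _ from ha) (q.drop j)))
      simp only [Walk.length_append, Walk.length_cons] at this
      omega
    · rintro rfl
      exact q.adj_getVert_succ (by omega)
  refine ⟨q.length, fun i => q.getVert i, ⟨?_, ?_⟩, by simp, by simp, ?_⟩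
  · intro i hi j hj hij
    rcases lt_trichotomy i j with hlt | rfl | hlt
    · exact absurd (Subtype.ext hij) (key i j hlt hj).1
    · rfl
    · exact absurd (Subtype.ext hij.symm) (key j i hlt hi).1
  · intro i hi j hj
    rcases lt_trichotomy i j with hlt | rfl | hlt
    · rw [(key i j hlt hj).2]; omega
    · simp
    · rw [G.adj_comm, (key j i hlt hi).2]; omega
  · intro i _
    exact ⟨(q.getVert i).2, (q.take i).reachable⟩

/-! ### Consequences of girth five. -/

theorem MemG.no_triangle (hG : MemG 2 G) {a b c : V} (h1 : G.Adj a b) (h2 : G.Adj b c)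
    (h3 : G.Adj c a) : False := by
  have hc : (Walk.cons h1 (Walk.cons h2 (Walk.cons h3 Walk.nil))).IsCycle := by
    simp [Walk.cons_isCycle_iff, h1.ne, h2.ne, h3.ne, h1.ne', h3.ne']
  have := egirth_le_length hc
  rw [hG.egirth_eq] at this
  simp only [Walk.length_cons, Walk.length_nil] at this
  norm_cast at this

theorem MemG.no_square (hG : MemG 2 G) {a b c d : V} (h1 : G.Adj a b) (h2 : G.Adj b c)
    (h3 : G.Adj c d) (h4 : G.Adj d a) (hac : a ≠ c) (hbd : b ≠ d) : False := by
  have hc : (Walk.cons h1 (Walk.cons h2 (Walk.cons h3 (Walk.cons h4 Walk.nil)))).IsCycle := by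
    simp [Walk.cons_isCycle_iff, h1.ne, h2.ne, h3.ne, h4.ne, h1.ne', h4.ne',
      hac, hbd, hac.symm]
  have := egirth_le_length hc
  rw [hG.egirth_eq] at this
  simp only [Walk.length_cons, Walk.length_nil] at this
  norm_cast at this

/-! ### Detours and attachments of outside paths. -/

/-- Every vertex outside the image of `φ` has at most one neighbour in it. -/
def SingleAttached (φ : K ↪g G) : Prop :=
  ∀ v ∉ Set.range φ, ∀ i j, G.Adj v (φ i) → G.Adj v (φ j) → i = j

/-- There are induced paths from `x` to `y` of length three and of length four whose
interiors avoid `Z`. -/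
def HasDetours (K : SimpleGraph (Fin n)) (Z : Fin n → Prop) (x y : Fin n) : Prop :=
  ¬ K.Adj x y ∧
  (∃ u, K.Adj x u ∧ ¬ Z u ∧ ¬ K.Adj u y ∧ ∃ v, K.Adj u v ∧ K.Adj v y ∧ ¬ Z v ∧ ¬ K.Adj x v) ∧
  (∃ u, K.Adj x u ∧ ¬ Z u ∧ ¬ K.Adj u y ∧ ∃ v, K.Adj v y ∧ ¬ Z v ∧ ¬ K.Adj x v ∧ ¬ K.Adj u v ∧
    ∃ w, K.Adj u w ∧ K.Adj w v ∧ ¬ Z w ∧ ¬ K.Adj x w ∧ ¬ K.Adj w y)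

instance [DecidableRel K.Adj] (Z : Fin n → Prop) [DecidablePred Z] (x y : Fin n) :
    Decidable (HasDetours K Z x y) := by
  unfold HasDetours; infer_instance

theorem HasDetours.mono {Z Z' : Fin n → Prop} {x y : Fin n} (h : HasDetours K Z x y)
    (hZ : ∀ i, Z' i → Z i) : HasDetours K Z' x y := by
  obtain ⟨h0, ⟨u, a1, a2, a3, v, a4, a5, a6, a7⟩, ⟨u', b1, b2, b3, v', b4, b5, b6, b7, w, b8, b9,
    b10, b11, b12⟩⟩ := h
  exact ⟨h0, ⟨u, a1, fun h => a2 (hZ _ h), a3, v, a4, a5, fun h => a6 (hZ _ h), a7⟩,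
    ⟨u', b1, fun h => b2 (hZ _ h), b3, v', b4, fun h => b5 (hZ _ h), b6, b7, w, b8, b9,
      fun h => b10 (hZ _ h), b11, b12⟩⟩

theorem HasDetours.exists_three {Z : Fin n → Prop} {x y : Fin n} (h : HasDetours K Z x y) :
    ∃ g, IsIndPath K g 3 ∧ g 0 = x ∧ g 3 = y ∧ ∀ j, 0 < j → j < 3 → ¬ Z (g j) := by
  obtain ⟨h0, ⟨u, a1, a2, a3, v, a4, a5, a6, a7⟩, -⟩ := h
  refine ⟨fun t => [x, u, v, y].getD t x, isIndPath_of_list [x, u, v, y] x ?_, rfl, rfl, ?_⟩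
  · have e1 : x ≠ v := fun h => h0 (h ▸ a5)
    have e2 : u ≠ y := fun h => h0 (h ▸ a1)
    have e3 : x ≠ y := fun h => a3 (h ▸ a1.symm)
    intro i hi j hj hij
    simp only [List.length_cons, List.length_nil] at hi hj
    interval_cases j <;> interval_cases i <;> simp_all [a1.ne, a4.ne, a5.ne]
  · intro j h1 h2
    interval_cases j <;> simpa

theorem HasDetours.exists_four {Z : Fin n → Prop} {x y : Fin n} (h : HasDetours K Z x y) :
    ∃ g, IsIndPath K g 4 ∧ g 0 = x ∧ g 4 = y ∧ ∀ j, 0 < j → j < 4 → ¬ Z (g j) := by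
  obtain ⟨h0, -, ⟨u, b1, b2, b3, v, b4, b5, b6, b7, w, b8, b9, b10, b11, b12⟩⟩ := h
  refine ⟨fun t => [x, u, w, v, y].getD t x, isIndPath_of_list [x, u, w, v, y] x ?_, rfl, rfl, ?_⟩
  · have e1 : x ≠ v := fun h => h0 (h ▸ b4)
    have e2 : u ≠ y := fun h => h0 (h ▸ b1)
    have e3 : x ≠ y := fun h => b3 (h ▸ b1.symm)
    have e4 : x ≠ w := fun h => b6 (h ▸ b9)
    have e5 : u ≠ v := fun h => b3 (h ▸ b4)
    have e6 : w ≠ y := fun h => b3 (h ▸ b8)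
    intro i hi j hj hij
    simp only [List.length_cons, List.length_nil] at hi hj
    interval_cases j <;> interval_cases i <;> simp_all [b1.ne, b4.ne, b8.ne, b9.ne]
  · intro j h1 h2
    interval_cases j <;> simpa

open Classical in
/-- The vertices of `K` whose images are adjacent to one of `p 0, …, p k`. -/
noncomputable def pathAttach (φ : K ↪g G) (p : ℕ → V) (k : ℕ) : Finset (Fin n) :=
  Finset.univ.filter fun i => ∃ t ≤ k, G.Adj (p t) (φ i)

theorem mem_pathAttach {φ : K ↪g G} {p : ℕ → V} {k : ℕ} {i : Fin n} :
    i ∈ pathAttach φ p k ↔ ∃ t ≤ k, G.Adj (p t) (φ i) := by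
  simp [pathAttach]

/-- Adding end vertices to an induced path. -/
theorem IsIndPath.extend {p : ℕ → V} {k : ℕ} (hp : IsIndPath G p k) {a b : V} (hab : a ≠ b)
    (hnab : ¬ G.Adj a b) (ha : ∀ t ≤ k, p t ≠ a ∧ (G.Adj (p t) a ↔ t = 0))
    (hb : ∀ t ≤ k, p t ≠ b ∧ (G.Adj (p t) b ↔ t = k)) :
    IsIndPath G (fun t => if t = 0 then a else if t ≤ k + 1 then p (t - 1) else b) (k + 2) := by
  have key : ∀ i j, i < j → j ≤ k + 2 →
      ((if i = 0 then a else if i ≤ k + 1 then p (i - 1) else b) ≠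
        (if j = 0 then a else if j ≤ k + 1 then p (j - 1) else b)) ∧
      (G.Adj (if i = 0 then a else if i ≤ k + 1 then p (i - 1) else b)
        (if j = 0 then a else if j ≤ k + 1 then p (j - 1) else b) ↔ j = i + 1) := by
    intro i j hij hj
    rw [if_neg (show j ≠ 0 by omega)]
    by_cases hi0 : i = 0
    · rw [if_pos hi0]
      by_cases hjk : j ≤ k + 1
      · rw [if_pos hjk]
        obtain ⟨h1, h2⟩ := ha (j - 1) (by omega)
        refine ⟨h1.symm, ?_⟩
        rw [G.adj_comm, h2]; omega
      · rw [if_neg hjk]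
        refine ⟨hab, ?_⟩
        simp only [hnab, false_iff]; omega
    · rw [if_neg hi0, if_pos (show i ≤ k + 1 by omega)]
      by_cases hjk : j ≤ k + 1
      · rw [if_pos hjk]
        refine ⟨fun h => ?_, ?_⟩
        · have := hp.inj _ (by omega) _ (by omega) h; omega
        · rw [hp.adj _ (by omega) _ (by omega)]; omega
      · rw [if_neg hjk]
        obtain ⟨h1, h2⟩ := hb (i - 1) (by omega)
        refine ⟨h1, ?_⟩
        rw [h2]; omega
  constructor
  · intro i hi j hj hij
    rcases lt_trichotomy i j with hlt | rfl | hlt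
    · exact absurd hij (key i j hlt hj).1
    · rfl
    · exact absurd hij.symm (key j i hlt hi).1
  · intro i hi j hj
    rcases lt_trichotomy i j with hlt | rfl | hlt
    · rw [(key i j hlt hj).2]; omega
    · simp
    · rw [G.adj_comm, (key j i hlt hi).2]; omega

/-- A set of attachments is controlled by detours: if `F` holds for `Z ∪ {x}` and `Z ∪ {y}` but
not for `Z ∪ {x, y}`, then there are detours from `x` to `y` around `Z`. -/
def IsDetourFamily (K : SimpleGraph (Fin n)) (F : Finset (Fin n) → Prop) : Prop :=
  F ∅ ∧ (∀ i, F {i}) ∧ ∀ Z x y, x ∉ Z → y ∉ Z → x ≠ y → F (insert x Z) → F (insert y Z) →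
    ¬ F (insert x (insert y Z)) → HasDetours K (· ∈ Z) x y

/-- Induction on the length: dropping either end vertex of the path gives attachments in `F`, so a
failure must come from the two ends jointly. -/
theorem pathAttach_of_isDetourFamily (hG : MemG 2 G) {φ : K ↪g G} (hφ : SingleAttached φ)
    {F : Finset (Fin n) → Prop} (hF : IsDetourFamily K F) (k : ℕ) (p : ℕ → V)
    (hp : IsIndPath G p k) (hout : ∀ i ≤ k, p i ∉ Set.range φ) : F (pathAttach φ p k) := by
  induction k generalizing p with
  | zero =>
    rcases (pathAttach φ p 0).eq_empty_or_nonempty with h | ⟨i, hi⟩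
    · rw [h]; exact hF.1
    · have : pathAttach φ p 0 = {i} := by
        ext j
        rw [mem_pathAttach] at hi
        obtain ⟨t, ht, hti⟩ := hi
        obtain rfl := Nat.le_zero.mp ht
        rw [mem_pathAttach, Finset.mem_singleton]
        constructor
        · rintro ⟨s, hs, hsj⟩
          obtain rfl := Nat.le_zero.mp hs
          exact hφ _ (hout 0 le_rfl) _ _ hsj hti
        · rintro rfl; exact ⟨0, le_rfl, hti⟩
      rw [this]; exact hF.2.1 i
  | succ k ih =>
    set N := pathAttach φ p (k + 1) with hN
    set A := pathAttach φ p k with hA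
    set B := pathAttach φ (fun t => p (t + 1)) k with hB
    have hFA : F A := ih p (hp.mono (by omega)) fun i hi => hout i (by omega)
    have hFB : F B := ih _ hp.shift fun i hi => hout _ (by omega)
    have hAN : A ⊆ N := by
      intro i hi
      obtain ⟨t, ht, h⟩ := mem_pathAttach.mp hi
      exact mem_pathAttach.mpr ⟨t, by omega, h⟩
    have hBN : B ⊆ N := by
      intro i hi
      obtain ⟨t, ht, h⟩ := mem_pathAttach.mp hi
      exact mem_pathAttach.mpr ⟨t + 1, by omega, h⟩
    by_contra hFN
    obtain ⟨x, hxN, hxB⟩ : ∃ x ∈ N, x ∉ B := by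
      by_contra! h
      exact hFN (Finset.Subset.antisymm hBN h ▸ hFB)
    obtain ⟨y, hyN, hyA⟩ : ∃ y ∈ N, y ∉ A := by
      by_contra! h
      exact hFN (Finset.Subset.antisymm hAN h ▸ hFA)
    have hx : ∀ t ≤ k + 1, G.Adj (p t) (φ x) → t = 0 := by
      intro t ht h
      by_contra h0
      exact hxB (mem_pathAttach.mpr ⟨t - 1, by omega, by
        rwa [Nat.sub_add_cancel (by omega)]⟩)
    have hy : ∀ t ≤ k + 1, G.Adj (p t) (φ y) → t = k + 1 := by
      intro t ht h
      by_contra h0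
      exact hyA (mem_pathAttach.mpr ⟨t, by omega, h⟩)
    have hx0 : G.Adj (p 0) (φ x) := by
      obtain ⟨t, ht, h⟩ := mem_pathAttach.mp hxN
      obtain rfl := hx t ht h
      exact h
    have hyk : G.Adj (p (k + 1)) (φ y) := by
      obtain ⟨t, ht, h⟩ := mem_pathAttach.mp hyN
      obtain rfl := hy t ht h
      exact h
    have hxy : x ≠ y := by
      rintro rfl
      have := hx _ le_rfl hyk
      omega
    -- By single attachment the last vertex sees only y, so dropping it loses y alone. The same
    -- holds for x at the other end.
    have hAeq : insert x ((N.erase x).erase y) = A := by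
      ext i
      simp only [Finset.mem_insert, Finset.mem_erase]
      constructor
      · rintro (rfl | ⟨hiy, hix, hiN⟩)
        · exact mem_pathAttach.mpr ⟨0, by omega, hx0⟩
        · obtain ⟨t, ht, h⟩ := mem_pathAttach.mp hiN
          rcases Nat.lt_or_ge k t with hlt | hle
          · obtain rfl : t = k + 1 := by omega
            exact absurd (hφ _ (hout _ ht) _ _ h hyk) hiy
          · exact mem_pathAttach.mpr ⟨t, hle, h⟩
      · intro hi
        by_cases hix : i = x
        · exact Or.inl hix
        · exact Or.inr ⟨fun h => hyA (h ▸ hi), hix, hAN hi⟩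
    have hBeq : insert y ((N.erase x).erase y) = B := by
      ext i
      simp only [Finset.mem_insert, Finset.mem_erase]
      constructor
      · rintro (rfl | ⟨hiy, hix, hiN⟩)
        · exact mem_pathAttach.mpr ⟨k, le_rfl, hyk⟩
        · obtain ⟨t, ht, h⟩ := mem_pathAttach.mp hiN
          rcases Nat.eq_zero_or_pos t with rfl | hpos
          · exact absurd (hφ _ (hout _ ht) _ _ h hx0) hix
          · exact mem_pathAttach.mpr ⟨t - 1, by omega, by
              rwa [Nat.sub_add_cancel (by omega)]⟩
      · intro hi
        by_cases hiy : i = y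
        · exact Or.inl hiy
        · exact Or.inr ⟨hiy, fun h => hxB (h ▸ hi), hBN hi⟩
    have hNeq : insert x (insert y ((N.erase x).erase y)) = N := by
      rw [Finset.insert_erase (Finset.mem_erase.mpr ⟨hxy.symm, hyN⟩), Finset.insert_erase hxN]
    have hdet := hF.2.2 ((N.erase x).erase y) x y (by simp) (by simp) hxy
      (by rwa [hAeq]) (by rwa [hBeq]) (by rwa [hNeq])
    have hf := hp.extend (φ.injective.ne hxy) (fun h => hdet.1 (φ.map_rel_iff.mp h))
      (fun t ht => ⟨fun h => hout t ht ⟨x, h.symm⟩, hx t ht, fun h => h ▸ hx0⟩)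
      (fun t ht => ⟨fun h => hout t ht ⟨y, h.symm⟩, hy t ht, fun h => h ▸ hyk⟩)
    -- The path with its ends x and y has length k + 3 ≥ 3. If this is even it is at least 4 and the
    -- detour of length 3 is used; if odd, the detour of length 4. Either way the hole is odd with
    -- length at least 7.
    have main : ∀ m g, 3 ≤ m → m ≤ 4 → IsIndPath K g m → g 0 = x → g m = y →
        (∀ j, 0 < j → j < m → g j ∉ (N.erase x).erase y) → Odd (k + 1 + 2 + m) →
        7 ≤ k + 1 + 2 + m → False := by
      intro m g hm3 hm4 hg hg0 hgm hgZ hodd h7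
      refine hG.not_odd_theta hf (hg.map φ) (by simp [hg0]) (by simp [hgm]) (by omega) (by omega)
        ?_ hodd h7
      intro i j hi0 hi hj0 hj
      rw [if_neg (by omega), if_pos (by omega)]
      refine ⟨fun h => hout (i - 1) (by omega) ⟨_, h.symm⟩, fun h => ?_⟩
      apply hgZ j hj0 hj
      rw [Finset.mem_erase, Finset.mem_erase]
      refine ⟨fun h' => ?_, fun h' => ?_, mem_pathAttach.mpr ⟨i - 1, by omega, h⟩⟩
      · have := hg.inj _ hj.le _ le_rfl (h'.trans hgm.symm); omega
      · have := hg.inj _ hj.le _ (by omega) (h'.trans hg0.symm); omega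
    rcases Nat.even_or_odd (k + 1 + 2) with he | ho
    · obtain ⟨g, hg, hg0, hg3, hgZ⟩ := hdet.exists_three
      refine main 3 g le_rfl (by omega) hg hg0 hg3 hgZ (he.add_odd (by decide)) ?_
      obtain ⟨r, hr⟩ := he
      omega
    · obtain ⟨g, hg, hg0, hg4, hgZ⟩ := hdet.exists_four
      exact main 4 g (by omega) le_rfl hg hg0 hg4 hgZ (ho.add_even (by decide)) (by omega)

/-! ### Outside components and the cutsets they define. -/

/-- `v` and `w` lie in the same component of the subgraph induced by `O`. -/
def SameComp (G : SimpleGraph V) (O : Set V) (v w : V) : Prop :=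
  ∃ (hv : v ∈ O) (hw : w ∈ O), (G.induce O).Reachable ⟨v, hv⟩ ⟨w, hw⟩

open Classical in
/-- The vertices of `K` whose images have a neighbour in the component of `v` in `O`. -/
noncomputable def compAttach (φ : K ↪g G) (O : Set V) (v : V) : Finset (Fin n) :=
  Finset.univ.filter fun i => ∃ w, SameComp G O v w ∧ G.Adj w (φ i)

theorem mem_compAttach {φ : K ↪g G} {O : Set V} {v : V} {i : Fin n} :
    i ∈ compAttach φ O v ↔ ∃ w, SameComp G O v w ∧ G.Adj w (φ i) := by
  simp [compAttach]

theorem exists_pathAttach_subset {φ : K ↪g G} {O : Set V} {v : V} {i j : Fin n}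
    (hi : i ∈ compAttach φ O v) (hj : j ∈ compAttach φ O v) :
    ∃ k p, IsIndPath G p k ∧ (∀ t ≤ k, p t ∈ O) ∧ i ∈ pathAttach φ p k ∧
      j ∈ pathAttach φ p k ∧ pathAttach φ p k ⊆ compAttach φ O v := by
  obtain ⟨u, ⟨hv, hu, hvu⟩, hui⟩ := mem_compAttach.mp hi
  obtain ⟨w, ⟨_, hw, hvw⟩, hwj⟩ := mem_compAttach.mp hj
  obtain ⟨k, p, hp, hp0, hpk, hpO⟩ := exists_isIndPath_of_reachable (hvu.symm.trans hvw)
  refine ⟨k, p, hp, fun t ht => (hpO t ht).1, mem_pathAttach.mpr ⟨0, by omega, by rwa [hp0]⟩,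
    mem_pathAttach.mpr ⟨k, le_rfl, by rwa [hpk]⟩, fun l hl => ?_⟩
  obtain ⟨t, ht, h⟩ := mem_pathAttach.mp hl
  obtain ⟨hO, hr⟩ := hpO t ht
  exact mem_compAttach.mpr ⟨p t, ⟨hv, hO, hvu.trans hr⟩, h⟩

/-- Any two attachments of a component are attachments of a single induced path inside it, so a
pattern expressed through pairs passes from paths to components. -/
theorem compAttach_of_isDetourFamily (hG : MemG 2 G) {φ : K ↪g G} (hφ : SingleAttached φ)
    {F : Finset (Fin n) → Prop} (hF : IsDetourFamily K F)
    (hpair : ∀ N, (∀ i ∈ N, ∀ j ∈ N, ∃ A ⊆ N, F A ∧ i ∈ A ∧ j ∈ A) → F N)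
    {O : Set V} (hO : O = (Set.range φ)ᶜ) (v : V) : F (compAttach φ O v) := by
  refine hpair _ fun i hi j hj => ?_
  obtain ⟨k, p, hp, hpO, h1, h2, h3⟩ := exists_pathAttach_subset hi hj
  exact ⟨_, h3, pathAttach_of_isDetourFamily hG hφ hF k p hp fun t ht => by
    have := hpO t ht; rwa [hO] at this, h1, h2⟩

/-- A walk leaving the component must first meet one of its attachments. -/
theorem isCutset_compAttach {φ : K ↪g G} {O : Set V} (hO : O = (Set.range φ)ᶜ) {v : V}
    (hv : v ∈ O) {z : Fin n} (hz : z ∉ compAttach φ O v) :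
    IsCutset G ((compAttach φ O v).map φ.toEmbedding) := by
  intro hpre
  set S := (compAttach φ O v).map φ.toEmbedding with hS
  have hvS : v ∈ ((S : Set V)ᶜ) := by
    intro h
    obtain ⟨i, -, rfl⟩ := Finset.mem_map.mp (Finset.mem_coe.mp h)
    rw [hO] at hv
    exact hv ⟨i, rfl⟩
  have hzS : φ z ∈ ((S : Set V)ᶜ) := by
    intro h
    obtain ⟨i, hi, h⟩ := Finset.mem_map.mp (Finset.mem_coe.mp h)
    exact hz (φ.injective h ▸ hi)
  obtain ⟨q⟩ := hpre ⟨v, hvS⟩ ⟨φ z, hzS⟩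
  have key : ∀ {a b : ((S : Set V)ᶜ : Set V)} (_ : (G.induce ((S : Set V)ᶜ)).Walk a b),
      SameComp G O v a → SameComp G O v b := by
    intro a b q
    induction q with
    | nil => exact id
    | @cons a c b h q ih =>
      intro ha
      apply ih
      obtain ⟨h1, h2, h3⟩ := ha
      have hac : G.Adj a c := h
      have hc : (c : V) ∈ O := by
        rw [hO]
        rintro ⟨i, hi⟩
        apply c.2
        exact Finset.mem_coe.mpr <| Finset.mem_map.mpr ⟨i, mem_compAttach.mpr ⟨a, ⟨h1, h2, h3⟩, hi ▸ hac⟩, hi⟩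
      exact ⟨h1, hc, h3.trans (Adj.reachable (show (G.induce O).Adj ⟨a, h2⟩ ⟨c, hc⟩ from hac))⟩
  obtain ⟨-, h, -⟩ := key q ⟨hv, hv, Reachable.refl _⟩
  rw [hO] at h
  exact h ⟨z, rfl⟩

theorem IsKConnected.not_isCutset {k : ℕ} (h : IsKConnected k G) {S : Finset V}
    (hS : S.card < k) : ¬ IsCutset G S :=
  fun hc => hc (h.2 S hS).preconnected

theorem IsKConnected.exists_adj_notMem {k : ℕ} (h : IsKConnected k G) (x : V) {T : Finset V}
    (hT : T.card < k) : ∃ y ∉ T, G.Adj x y := by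
  classical
  by_contra! hno
  -- Deleting `T` without x keeps x, and connectedness then supplies an edge from x to a remaining
  -- vertex.
  have hT' : (T.erase x).card < k := (Finset.card_erase_le).trans_lt hT
  obtain ⟨y, hy⟩ : ∃ y, y ∉ insert x (T.erase x) := by
    by_contra! hall
    have h1 : ENat.card V ≤ (insert x (T.erase x)).card := by
      rw [← Set.encard_univ, ← Set.encard_coe_eq_coe_finsetCard]
      exact Set.encard_le_encard fun z _ => Finset.mem_coe.mpr (hall z)
    have h2 : (insert x (T.erase x)).card ≤ k := (Finset.card_insert_le _ _).trans hT'
    exact absurd h.1 (not_lt.mpr (h1.trans (by exact_mod_cast h2)))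
  rw [Finset.mem_insert, not_or] at hy
  have hx : x ∈ (((T.erase x : Finset V) : Set V)ᶜ) := by simp
  obtain ⟨q⟩ := (h.2 _ hT').preconnected ⟨x, hx⟩ ⟨y, fun h => hy.2 (Finset.mem_coe.mp h)⟩
  cases q with
  | nil => exact hy.1 rfl
  | @cons _ c _ h1 _ =>
    have hxc : G.Adj x c := h1
    have hc := c.2
    rw [Set.mem_compl_iff, Finset.mem_coe, Finset.mem_erase, not_and] at hc
    by_cases hcT : (c : V) ∈ T
    · exact hc hxc.ne' hcT
    · exact hno _ hcT hxc

/-- If few vertices of `K` can be attached to a component, then `K` is everything. -/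
theorem surjective_of_card_compAttach_lt {k : ℕ} (hconn : IsKConnected k G) {φ : K ↪g G}
    (hk : k ≤ n) (h : ∀ v, (compAttach φ (Set.range φ)ᶜ v).card < k) :
    Function.Surjective φ := by
  intro v
  by_contra hv
  obtain ⟨z, hz⟩ : ∃ z, z ∉ compAttach φ (Set.range φ)ᶜ v := by
    by_contra! hall
    have := h v
    rw [Finset.eq_univ_of_forall hall, Finset.card_univ, Fintype.card_fin] at this
    omega
  exact hconn.not_isCutset (by rw [Finset.card_map]; exact h v)
    (isCutset_compAttach rfl (show v ∈ (Set.range φ)ᶜ from hv) hz)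

/-- Two nonadjacent attachments of a component are joined by an induced path through it. -/
theorem exists_isIndPath_through {φ : K ↪g G} (hφ : SingleAttached φ) {O : Set V}
    (hO : O = (Set.range φ)ᶜ) {v : V} {x y : Fin n} (hxy : x ≠ y) (hnadj : ¬ K.Adj x y)
    (hx : x ∈ compAttach φ O v) (hy : y ∈ compAttach φ O v) :
    ∃ m f, 3 ≤ m ∧ IsIndPath G f m ∧ f 0 = φ x ∧ f m = φ y ∧
      ∀ t, 0 < t → t < m → SameComp G O v (f t) := by
  obtain ⟨u, hu, hux⟩ := mem_compAttach.mp hx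
  obtain ⟨w, hw, hwy⟩ := mem_compAttach.mp hy
  -- A shortest path in the component plus the two ends is wanted. Length two is impossible because
  -- its middle vertex would have two neighbours in `K`.
  set O' : Set V := {a | a = φ x ∨ a = φ y ∨ SameComp G O v a} with hO'
  have hlift : ∀ {a b : O} (_ : (G.induce O).Walk a b) (ha : SameComp G O v a)
      (hb : SameComp G O v b),
      (G.induce O').Reachable ⟨a, Or.inr (Or.inr ha)⟩ ⟨b, Or.inr (Or.inr hb)⟩ := by
    intro a b q
    induction q with
    | nil => intro _ _; exact Reachable.refl _
    | @cons a c b h q ih =>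
      intro ha hb
      have hac : G.Adj a c := h
      obtain ⟨h1, h2, h3⟩ := ha
      have hc : SameComp G O v c := ⟨h1, c.2, h3.trans h.reachable⟩
      exact (Adj.reachable (show (G.induce O').Adj ⟨a, Or.inr (Or.inr ⟨h1, h2, h3⟩)⟩
        ⟨c, Or.inr (Or.inr hc)⟩ from hac)).trans (ih hc hb)
  obtain ⟨hv, hu', hvu⟩ := id hu
  obtain ⟨_, hw', hvw⟩ := id hw
  obtain ⟨q⟩ := hvu.symm.trans hvw
  have hr : (G.induce O').Reachable ⟨φ x, Or.inl rfl⟩ ⟨φ y, Or.inr (Or.inl rfl)⟩ :=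
    ((Adj.reachable (show (G.induce O').Adj ⟨φ x, Or.inl rfl⟩ ⟨u, Or.inr (Or.inr hu)⟩
      from hux.symm)).trans (hlift q hu hw)).trans
      (Adj.reachable (show (G.induce O').Adj ⟨w, Or.inr (Or.inr hw)⟩
        ⟨φ y, Or.inr (Or.inl rfl)⟩ from hwy))
  obtain ⟨m, f, hf, hf0, hfm, hfO⟩ := exists_isIndPath_of_reachable hr
  have hint : ∀ t, 0 < t → t < m → SameComp G O v (f t) := by
    intro t h0 hm
    obtain ⟨h | h | h, -⟩ := hfO t hm.le
    · have := hf.inj t hm.le 0 (by omega) (h.trans hf0.symm); omega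
    · have := hf.inj t hm.le m le_rfl (h.trans hfm.symm); omega
    · exact h
  refine ⟨m, f, ?_, hf, hf0, hfm, hint⟩
  by_contra! hm
  have h0 : m ≠ 0 := by
    rintro rfl
    exact hxy (φ.injective (hf0.symm.trans hfm))
  have h1 : m ≠ 1 := by
    rintro rfl
    have := (hf.adj 0 (by omega) 1 le_rfl).mpr (Or.inl rfl)
    rw [hf0, hfm] at this
    exact hnadj (φ.map_rel_iff.mp this)
  obtain rfl : m = 2 := by omega
  have h2 := (hf.adj 1 (by omega) 0 (by omega)).mpr (Or.inr rfl)
  have h3 := (hf.adj 1 (by omega) 2 (by omega)).mpr (Or.inl rfl)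
  rw [hf0] at h2
  rw [hfm] at h3
  obtain ⟨-, h4, -⟩ := hint 1 (by omega) (by omega)
  rw [hO] at h4
  exact hxy (hφ _ h4 _ _ h2 h3)

/-! ### Concrete graphs and finite checks. -/

/-- The graph on `Fin n` with the given edges. -/
def edgeGraph {n : ℕ} (E : List (Fin n × Fin n)) : SimpleGraph (Fin n) where
  Adj i j := i ≠ j ∧ ((i, j) ∈ E ∨ (j, i) ∈ E)
  symm := ⟨fun _ _ h => ⟨h.1.symm, h.2.symm⟩⟩
  loopless := ⟨fun _ h => h.1 rfl⟩

instance {n : ℕ} (E : List (Fin n × Fin n)) : DecidableRel (edgeGraph E).Adj :=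
  fun i j => inferInstanceAs (Decidable (i ≠ j ∧ ((i, j) ∈ E ∨ (j, i) ∈ E)))

/-- The graph `θ⁺` as an octagon with two crossing long chords. -/
abbrev octagon : SimpleGraph (Fin 8) :=
  edgeGraph [(0, 1), (1, 2), (2, 3), (3, 4), (4, 5), (5, 6), (6, 7), (7, 0), (0, 4), (2, 6)]

/-- The Petersen graph without one vertex. -/
abbrev petersenSubVertex : SimpleGraph (Fin 9) :=
  edgeGraph [(0, 1), (1, 2), (2, 3), (3, 4), (4, 5), (5, 6), (6, 7), (7, 0), (0, 4), (2, 6),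
    (8, 3), (8, 7)]

/-- The Petersen graph without one edge. -/
abbrev petersenSubEdge : SimpleGraph (Fin 10) :=
  edgeGraph [(0, 1), (1, 2), (2, 3), (3, 4), (4, 5), (5, 6), (6, 7), (7, 0), (0, 4), (2, 6),
    (8, 3), (8, 7), (9, 1), (9, 5)]

/-- The Petersen graph on `Fin 10`. -/
abbrev finPetersen : SimpleGraph (Fin 10) :=
  edgeGraph [(0, 1), (1, 2), (2, 3), (3, 4), (4, 5), (5, 6), (6, 7), (7, 0), (0, 4), (2, 6),
    (8, 3), (8, 7), (9, 1), (9, 5), (8, 9)]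

/-- Pairs of vertices of `octagon` that are not attached to the same component. -/
def exclusivePairs : List (Fin 8 × Fin 8) := [(0, 2), (0, 6), (4, 2), (4, 6), (1, 5), (3, 7)]

/-- Triples of vertices of `octagon` such that a component attached to the first two is attached
to the third. -/
def forcedTriples : List (Fin 8 × Fin 8 × Fin 8) :=
  [(1, 4, 3), (3, 0, 1), (3, 6, 5), (5, 2, 3), (5, 0, 7), (7, 4, 5), (7, 2, 1), (1, 6, 7)]

/-- Possible attachments to `octagon`. -/
def OctagonFamily (Z : Fin 8 → Prop) : Prop :=
  (∀ e ∈ exclusivePairs, ¬ (Z e.1 ∧ Z e.2)) ∧ (∀ e ∈ forcedTriples, Z e.1 → Z e.2.1 → Z e.2.2)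

instance (Z : Fin 8 → Prop) [DecidablePred Z] : Decidable (OctagonFamily Z) :=
  @instDecidableAnd (∀ e ∈ exclusivePairs, ¬ (Z e.1 ∧ Z e.2))
    (∀ e ∈ forcedTriples, Z e.1 → Z e.2.1 → Z e.2.2) inferInstance inferInstance

/-- Coding subsets as bit masks turns statements about all attachment sets into bounded checks. -/
theorem exists_testBit_iff {n : ℕ} (A : Finset (Fin n)) :
    ∃ m < 2 ^ n, ∀ i : Fin n, i ∈ A ↔ m.testBit i = true :=
  ⟨Nat.ofBits fun i => decide (i ∈ A), Nat.ofBits_lt_two_pow _, fun i => by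
    simp [Nat.testBit_ofBits_lt _ _ i.2]⟩

set_option synthInstance.maxHeartbeats 400000 in
set_option synthInstance.maxSize 2000 in
theorem hasDetours_octagon_testBit : ∀ m < 2 ^ 8, OctagonFamily (fun i => m.testBit i = true) →
    ∀ x : Fin 8, m.testBit x = true → ∀ y : Fin 8, ¬ m.testBit y = true →
    OctagonFamily (fun i => i = y ∨ i ≠ x ∧ m.testBit i = true) →
    OctagonFamily (fun i => i = y ∨ m.testBit i = true) ∨
      HasDetours octagon (fun i => i ≠ x ∧ m.testBit i = true) x y := by
  decide +kernel

theorem isDetourFamily_octagon : IsDetourFamily octagon fun Z => OctagonFamily (· ∈ Z) := by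
  refine ⟨by decide +kernel, by decide +kernel, fun Z x y hx hy hxy h1 h2 h3 => ?_⟩
  -- The mask codes `Z` together with x, as in the finite check.
  obtain ⟨m, hm, hA⟩ := exists_testBit_iff (insert x Z)
  have hZ : ∀ i, i ∈ Z ↔ i ≠ x ∧ m.testBit i = true := by
    intro i
    rw [← hA, Finset.mem_insert]
    constructor
    · exact fun h => ⟨fun h' => hx (h' ▸ h), Or.inr h⟩
    · exact fun h => h.2.resolve_left h.1
  have h := hasDetours_octagon_testBit m hm (by simpa only [hA] using h1) x
    ((hA x).mp (Finset.mem_insert_self x Z)) y (by rw [← hA]; simp [hxy.symm, hy])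
    (by simpa only [Finset.mem_insert, hZ] using h2)
  simp only [← hZ] at h
  refine h.resolve_left fun h' => h3 ?_
  rw [Finset.insert_comm]
  simpa only [Finset.mem_insert (b := y), hA] using h'

set_option synthInstance.maxHeartbeats 400000 in
set_option synthInstance.maxSize 2000 in
theorem octagonFamily_cases_testBit : ∀ m < 2 ^ 8, OctagonFamily (fun i => m.testBit i = true) →
    (∃ a b : Fin 8, ∀ i : Fin 8, m.testBit i = true → i = a ∨ i = b) ∨
    (∃ a b c : Fin 8, octagon.Adj a b ∧ c ≠ a ∧ c ≠ b ∧
      ∀ i : Fin 8, m.testBit i = true ↔ i = a ∨ i = b ∨ i = c) ∨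
    (∀ i : Fin 8, m.testBit i = true ↔ i ∈ [1, 0, 4, 3]) ∨
    (∀ i : Fin 8, m.testBit i = true ↔ i ∈ [3, 2, 6, 5]) ∨
    (∀ i : Fin 8, m.testBit i = true ↔ i ∈ [5, 4, 0, 7]) ∨
    (∀ i : Fin 8, m.testBit i = true ↔ i ∈ [7, 6, 2, 1]) := by
  decide +kernel

theorem octagonFamily_cases (N : Finset (Fin 8)) (hN : OctagonFamily (· ∈ N)) :
    N.card < 3 ∨ (∃ a b c, octagon.Adj a b ∧ c ≠ a ∧ c ≠ b ∧ N = {a, b, c}) ∨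
    N = {1, 0, 4, 3} ∨ N = {3, 2, 6, 5} ∨ N = {5, 4, 0, 7} ∨ N = {7, 6, 2, 1} := by
  obtain ⟨m, hm, h⟩ := exists_testBit_iff N
  have := octagonFamily_cases_testBit m hm (by simpa only [h] using hN)
  simp only [← h] at this
  rcases this with ⟨a, b, hab⟩ | ⟨a, b, c, h1, h2, h3, h4⟩ | h | h | h | h
  · left
    exact (Finset.card_le_card fun i hi => by simpa using hab i hi).trans_lt
      ((Finset.card_le_two (a := a) (b := b)).trans_lt (by omega))
  · exact Or.inr (Or.inl ⟨a, b, c, h1, h2, h3, by ext i; simp [h4]⟩)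
  · exact Or.inr (Or.inr (Or.inl (by ext i; simp [h])))
  · exact Or.inr (Or.inr (Or.inr (Or.inl (by ext i; simp [h]))))
  · exact Or.inr (Or.inr (Or.inr (Or.inr (Or.inl (by ext i; simp [h])))))
  · exact Or.inr (Or.inr (Or.inr (Or.inr (Or.inr (by ext i; simp [h])))))

/-- The missing edge 8–9 is kept in the clique graph because no path of length three joins its ends.
-/
theorem hasDetours_petersenSubEdge : ∀ x y : Fin 10, x ≠ y → ¬ finPetersen.Adj x y →
    HasDetours petersenSubEdge (fun z => finPetersen.Adj x z ∧ finPetersen.Adj y z) x y := by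
  decide +kernel

/-! ### Components around θ⁺. -/

theorem SameComp.notMem_range {φ : K ↪g G} {O : Set V} (hO : O = (Set.range φ)ᶜ) {v w : V}
    (h : SameComp G O v w) (i : Fin n) : w ≠ φ i := by
  rintro rfl
  obtain ⟨-, h, -⟩ := h
  rw [hO] at h
  exact h ⟨i, rfl⟩

theorem SameComp.compAttach_eq {φ : K ↪g G} {O : Set V} {v w : V} (h : SameComp G O v w) :
    compAttach φ O v = compAttach φ O w := by
  obtain ⟨hv, hw, hvw⟩ := h
  ext i
  rw [mem_compAttach, mem_compAttach]
  constructor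
  · rintro ⟨u, ⟨_, hu, hvu⟩, hui⟩
    exact ⟨u, ⟨hw, hu, hvw.symm.trans hvu⟩, hui⟩
  · rintro ⟨u, ⟨_, hu, hwu⟩, hui⟩
    exact ⟨u, ⟨hv, hu, hvw.trans hwu⟩, hui⟩

theorem separated_of_compAttach_ne {φ : K ↪g G} {O : Set V} {v v' a b : V}
    (hne : compAttach φ O v ≠ compAttach φ O v') (ha : SameComp G O v a)
    (hb : SameComp G O v' b) : a ≠ b ∧ ¬ G.Adj a b := by
  obtain ⟨hv, ha', hva⟩ := id ha
  obtain ⟨hv', hb', hvb⟩ := id hb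
  constructor
  · rintro rfl
    exact hne (ha.compAttach_eq.trans hb.compAttach_eq.symm)
  · intro hab
    have : SameComp G O a b :=
      ⟨ha', hb', Adj.reachable (show (G.induce O).Adj ⟨a, ha'⟩ ⟨b, hb'⟩ from hab)⟩
    exact hne ((ha.compAttach_eq.trans this.compAttach_eq).trans hb.compAttach_eq.symm)

theorem separated_of_notMem_compAttach {φ : K ↪g G} {O : Set V} (hO : O = (Set.range φ)ᶜ)
    {v a : V} (ha : SameComp G O v a) {i : Fin n} (hi : i ∉ compAttach φ O v) :
    a ≠ φ i ∧ ¬ G.Adj a (φ i) :=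
  ⟨ha.notMem_range hO i, fun h => hi (mem_compAttach.mpr ⟨a, ha, h⟩)⟩

/-- A path through a component is even if its ends are joined by an induced path of length four
whose interior is not attached to the component. -/
theorem exists_even_isIndPath_through (hG : MemG 2 G) {φ : K ↪g G} (hφ : SingleAttached φ)
    {O : Set V} (hO : O = (Set.range φ)ᶜ) {v : V} {x y : Fin n}
    (hx : x ∈ compAttach φ O v) (hy : y ∈ compAttach φ O v) {g : ℕ → Fin n}
    (hg : IsIndPath K g 4) (hg0 : g 0 = x) (hg4 : g 4 = y)
    (hgN : ∀ j, 0 < j → j < 4 → g j ∉ compAttach φ O v) :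
    ∃ m f, 3 ≤ m ∧ Even m ∧ IsIndPath G f m ∧ f 0 = φ x ∧ f m = φ y ∧
      ∀ t, 0 < t → t < m → SameComp G O v (f t) := by
  have hxy : x ≠ y := by
    rintro rfl
    have := hg.inj 0 (by omega) 4 le_rfl (hg0.trans hg4.symm)
    omega
  have hnadj : ¬ K.Adj x y := by
    rw [← hg0, ← hg4, hg.adj 0 (by omega) 4 le_rfl]
    omega
  obtain ⟨m, f, hm, hf, hf0, hfm, hfc⟩ := exists_isIndPath_through hφ hO hxy hnadj hx hy
  refine ⟨m, f, hm, ?_, hf, hf0, hfm, hfc⟩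
  by_contra hodd
  rw [Nat.not_even_iff_odd] at hodd
  refine hG.not_odd_theta hf (hg.map φ) (by simp [hf0, hg0]) (by simp [hfm, hg4]) (by omega)
    (by omega) ?_ (hodd.add_even (by decide)) (by omega)
  intro i j hi0 hi hj0 hj
  exact separated_of_notMem_compAttach hO (hfc i hi0 hi) (hgN j hj0 hj)

theorem isIndPath_octagon_of_list (l : List (Fin 8))
    (h : ∀ i < l.length, ∀ j < l.length, i < j →
      l.getD i 0 ≠ l.getD j 0 ∧ (octagon.Adj (l.getD i 0) (l.getD j 0) ↔ j = i + 1)) :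
    IsIndPath octagon (fun t => l.getD t 0) (l.length - 1) :=
  isIndPath_of_list l 0 h

/-- Components attached around opposite chord ends of `octagon` do not coexist. -/
theorem not_opposite_compAttach (hG : MemG 2 G) {φ : octagon ↪g G} (hφ : SingleAttached φ)
    {O : Set V} (hO : O = (Set.range φ)ᶜ) {v v' : V}
    (hv : compAttach φ O v = {1, 0, 4, 3}) (hv' : compAttach φ O v' = {5, 4, 0, 7}) : False := by
  obtain ⟨m, f, hm, hme, hf, hf0, hfm, hfc⟩ := exists_even_isIndPath_through hG hφ hO
    (v := v) (x := 4) (y := 1) (by rw [hv]; decide) (by rw [hv]; decide)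
    (isIndPath_octagon_of_list [4, 5, 6, 2, 1] (by decide)) rfl rfl
    (by rw [hv]; intro j h0 h4; interval_cases j <;> decide)
  obtain ⟨m', f', hm', hme', hf', hf0', hfm', hfc'⟩ := exists_even_isIndPath_through hG hφ hO
    (v := v') (x := 4) (y := 7) (by rw [hv']; decide) (by rw [hv']; decide)
    (isIndPath_octagon_of_list [4, 3, 2, 6, 7] (by decide)) rfl rfl
    (by rw [hv']; intro j h0 h4; interval_cases j <;> decide)
  -- Both component paths start at 4 and are even; joining their other ends by 7, 6, 2, 1 adds three
  -- edges, so the hole is odd.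
  have hl := (isIndPath_octagon_of_list [7, 6, 2, 1] (by decide)).map φ
  have hg := hf'.append hl (by simpa using hfm') (by
    intro i j hi hj0 hj
    change j ≤ 3 at hj
    rcases Nat.eq_zero_or_pos i with rfl | hi0
    · rw [hf0']
      refine ⟨φ.injective.ne ?_, fun h => absurd (φ.map_rel_iff.mp h) ?_⟩ <;>
        (interval_cases j <;> decide)
    · refine separated_of_notMem_compAttach hO (hfc' i hi0 hi) ?_
      rw [hv']
      interval_cases j <;> decide)
  refine hG.not_odd_theta hf hg ?_ ?_ (by omega) (by simp) ?_ ?_ (by simp; omega)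
  · simp [hf0, hf0']
  · simp [hfm]
  · intro i j hi0 hi hj0 hj
    change j < m' + 3 at hj
    split_ifs with h
    · rcases h.eq_or_lt with rfl | h
      · rw [hfm']
        exact separated_of_notMem_compAttach hO (hfc i hi0 hi) (by rw [hv]; decide)
      · exact separated_of_compAttach_ne (φ := φ) (by rw [hv, hv']; decide) (hfc i hi0 hi)
          (hfc' j hj0 h)
    · refine separated_of_notMem_compAttach hO (hfc i hi0 hi) ?_
      rw [hv]
      obtain ⟨s, rfl⟩ : ∃ s, j = m' + s := ⟨j - m', by omega⟩
      have h0 : 0 < s := by omega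
      have h3 : s < 3 := by omega
      rw [Nat.add_sub_cancel_left]
      interval_cases s <;> decide
  · exact hme.add_odd (hme'.add_odd (by decide))

/-- The rotation of `octagon` exchanging its two chords. -/
def octagonRot : octagon ↪g octagon where
  toFun i := i + 2
  inj' := add_left_injective 2
  map_rel_iff' := by
    have : ∀ a b : Fin 8, octagon.Adj (a + 2) (b + 2) ↔ octagon.Adj a b := by decide +kernel
    exact fun {a b} => this a b

theorem range_octagonRot (φ : octagon ↪g G) : Set.range (φ.comp octagonRot) = Set.range φ := by
  ext w
  constructor
  · rintro ⟨i, rfl⟩; exact ⟨i + 2, rfl⟩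
  · rintro ⟨i, rfl⟩
    exact ⟨i - 2, congrArg φ (sub_add_cancel i 2)⟩

theorem mem_compAttach_octagonRot {φ : octagon ↪g G} {O : Set V} {v : V} {i : Fin 8} :
    i ∈ compAttach (φ.comp octagonRot) O v ↔ i + 2 ∈ compAttach φ O v := by
  rw [mem_compAttach, mem_compAttach]; rfl

theorem SingleAttached.comp_octagonRot {φ : octagon ↪g G} (hφ : SingleAttached φ) :
    SingleAttached (φ.comp octagonRot) := by
  intro v hv i j hi hj
  rw [range_octagonRot] at hv
  exact add_right_cancel (hφ v hv (i + 2) (j + 2) hi hj)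

theorem not_singleAttached_octagon (hG : MemG 2 G) (hconn : IsKConnected 3 G)
    (hcut : ∀ S : Finset V, S.card = 3 → IsCutset G S → G.IsIndepSet (S : Set V))
    (φ : octagon ↪g G) : ¬ SingleAttached φ := by
  intro hφ
  set O : Set V := (Set.range φ)ᶜ with hO
  have hcases : ∀ v ∈ O, compAttach φ O v = {1, 0, 4, 3} ∨ compAttach φ O v = {3, 2, 6, 5} ∨
      compAttach φ O v = {5, 4, 0, 7} ∨ compAttach φ O v = {7, 6, 2, 1} := by
    intro v hv
    have hF := compAttach_of_isDetourFamily hG hφ isDetourFamily_octagon (by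
      intro N hN
      refine ⟨fun e he h => ?_, fun e he h1 h2 => ?_⟩
      · obtain ⟨A, -, hA, h3, h4⟩ := hN _ h.1 _ h.2
        exact hA.1 e he ⟨h3, h4⟩
      · obtain ⟨A, hAN, hA, h3, h4⟩ := hN _ h1 _ h2
        exact hAN (hA.2 e he h3 h4)) hO v
    have hcutset : (compAttach φ O v).card < 8 →
        IsCutset G ((compAttach φ O v).map φ.toEmbedding) := by
      intro h
      obtain ⟨z, hz⟩ : ∃ z, z ∉ compAttach φ O v := by
        by_contra! hall
        rw [Finset.eq_univ_of_forall hall] at h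
        simp at h
      exact isCutset_compAttach hO hv hz
    rcases octagonFamily_cases _ hF with h | ⟨a, b, c, hab, hca, hcb, h⟩ | h
    · exact absurd (hcutset (by omega)) (hconn.not_isCutset (by rwa [Finset.card_map]))
    · exfalso
      have h3 : (compAttach φ O v).card = 3 := by
        rw [h, Finset.card_eq_three]
        exact ⟨a, b, c, hab.ne, hca.symm, hcb.symm, rfl⟩
      have hind := hcut _ (by rw [Finset.card_map, h3]) (hcutset (by omega))
      refine hind (x := φ a) ?_ (y := φ b) ?_ (φ.injective.ne hab.ne) (φ.map_rel_iff.mpr hab) <;>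
        simp [h]
    · exact h
  -- A vertex with at most two neighbours in the octagon has a further neighbour outside, by
  -- 3-connectivity.
  have hodd : ∀ i a b : Fin 8, (∀ j, octagon.Adj i j → j = a ∨ j = b) →
      ∃ v ∈ O, i ∈ compAttach φ O v := by
    classical
    intro i a b hab
    obtain ⟨v, hv, hiv⟩ := hconn.exists_adj_notMem (φ i) (T := {φ a, φ b})
      (Finset.card_le_two.trans_lt (by omega))
    have hvO : v ∈ O := by
      rintro ⟨j, rfl⟩
      apply hv
      rcases hab j (φ.map_rel_iff.mp hiv) with rfl | rfl <;> simp
    exact ⟨v, hvO, mem_compAttach.mpr ⟨v, ⟨hvO, hvO, Reachable.refl _⟩, hiv.symm⟩⟩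
  have hopp := fun v v' => not_opposite_compAttach hG hφ hO (v := v) (v' := v')
  have hopp' : ∀ v v', compAttach φ O v = {3, 2, 6, 5} → compAttach φ O v' = {7, 6, 2, 1} →
      False := by
    intro v v' hv hv'
    refine not_opposite_compAttach hG hφ.comp_octagonRot
      (by rw [range_octagonRot]) (v := v) (v' := v') ?_ ?_
    · ext i
      rw [mem_compAttach_octagonRot, hv]
      revert i; decide
    · ext i
      rw [mem_compAttach_octagonRot, hv']
      revert i; decide
  obtain ⟨v1, hv1, h1⟩ := hodd 1 0 2 (by decide)
  obtain ⟨v3, hv3, h3⟩ := hodd 3 2 4 (by decide)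
  obtain ⟨v5, hv5, h5⟩ := hodd 5 4 6 (by decide)
  obtain ⟨v7, hv7, h7⟩ := hodd 7 6 0 (by decide)
  -- The four sets meet the odd vertices in {1, 3}, {3, 5}, {5, 7}, {7, 1}; covering all four
  -- vertices needs two opposite sets.
  rcases hcases v1 hv1 with e1 | e1 | e1 | e1 <;> rw [e1] at h1 <;>
    first | (exact absurd h1 (by decide)) | skip
  all_goals
    rcases hcases v5 hv5 with e5 | e5 | e5 | e5 <;> rw [e5] at h5 <;>
      first | (exact absurd h5 (by decide)) | skip
  · rcases hcases v7 hv7 with e7 | e7 | e7 | e7 <;> rw [e7] at h7 <;>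
      first | (exact absurd h7 (by decide)) | skip
    · exact hopp _ _ e1 e7
    · exact hopp' _ _ e5 e7
  · exact hopp _ _ e1 e5
  · exact hopp' _ _ e5 e1
  · rcases hcases v3 hv3 with e3 | e3 | e3 | e3 <;> rw [e3] at h3 <;>
      first | (exact absurd h3 (by decide)) | skip
    · exact hopp _ _ e3 e5
    · exact hopp' _ _ e3 e1

/-! ### Copies with at most two attachments per component. -/

/-- Attachments that are cliques of `R` form a detour family if nonadjacent vertices have detours
around their common neighbours. -/
theorem isDetourFamily_clique {R : SimpleGraph (Fin n)}
    (h : ∀ x y, x ≠ y → ¬ R.Adj x y → HasDetours K (fun z => R.Adj x z ∧ R.Adj y z) x y) :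
    IsDetourFamily K fun Z => ∀ i ∈ Z, ∀ j ∈ Z, i ≠ j → R.Adj i j := by
  refine ⟨by simp, by simp, fun Z x y hx hy hxy h1 h2 h3 => ?_⟩
  have hxZ : ∀ z ∈ Z, R.Adj x z := fun z hz => h1 x (by simp) z (by simp [hz])
    fun e => hx (e ▸ hz)
  have hyZ : ∀ z ∈ Z, R.Adj y z := fun z hz => h2 y (by simp) z (by simp [hz])
    fun e => hy (e ▸ hz)
  refine (h x y hxy fun hadj => h3 ?_).mono fun z hz => ⟨hxZ z hz, hyZ z hz⟩
  intro i hi j hj hij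
  rw [Finset.mem_insert, Finset.mem_insert] at hi hj
  rcases hi with rfl | rfl | hi <;> rcases hj with rfl | rfl | hj
  · exact absurd rfl hij
  · exact hadj
  · exact hxZ j hj
  · exact hadj.symm
  · exact absurd rfl hij
  · exact hyZ j hj
  · exact (hxZ i hi).symm
  · exact (hyZ i hi).symm
  · exact h1 i (by simp [hi]) j (by simp [hj]) hij

/-- Attachments form a clique of the triangle-free graph `R`, so there are at most two of them. -/
theorem surjective_of_detours (hG : MemG 2 G) (hconn : IsKConnected 3 G) {φ : K ↪g G}
    (hφ : SingleAttached φ) {R : SimpleGraph (Fin n)} (hn : 3 ≤ n)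
    (h : ∀ x y, x ≠ y → ¬ R.Adj x y → HasDetours K (fun z => R.Adj x z ∧ R.Adj y z) x y)
    (hR : ∀ x y, R.Adj x y → ∀ z, R.Adj y z → ¬ R.Adj x z) : Function.Surjective φ := by
  refine surjective_of_card_compAttach_lt hconn hn fun v => ?_
  have hcl := compAttach_of_isDetourFamily hG hφ (isDetourFamily_clique h)
    (fun N hN i hi j hj hij => by
      obtain ⟨A, -, hA, h1, h2⟩ := hN i hi j hj
      exact hA i h1 j h2 hij) rfl v
  by_contra! hcard
  obtain ⟨a, ha, b, hb, c, hc, hab, hac, hbc⟩ := Finset.two_lt_card.mp (show 2 < _ from hcard)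
  exact hR a b (hcl a ha b hb hab) c (hcl b hb c hc hbc) (hcl a ha c hc hac)

/-! ### Outside vertices with several neighbours. -/

/-- Distinct vertices at distance at least three. -/
def Far (K : SimpleGraph (Fin n)) (i j : Fin n) : Prop :=
  i ≠ j ∧ ¬ K.Adj i j ∧ ∀ k, K.Adj i k → ¬ K.Adj j k

instance [DecidableRel K.Adj] (i j : Fin n) : Decidable (Far K i j) := by
  unfold Far; infer_instance

theorem MemG.far (hG : MemG 2 G) {φ : K ↪g G} {v : V} (hv : v ∉ Set.range φ) {i j : Fin n}
    (hij : i ≠ j) (hi : G.Adj v (φ i)) (hj : G.Adj v (φ j)) : Far K i j := by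
  refine ⟨hij, fun h => ?_, fun k hik hjk => ?_⟩
  · exact hG.no_triangle hi (φ.map_rel_iff.mpr h) hj.symm
  · exact hG.no_square hi (φ.map_rel_iff.mpr hik) (φ.map_rel_iff.mpr hjk.symm) hj.symm
      (fun h => hv ⟨k, h.symm⟩) (φ.injective.ne hij)

theorem exists_far_of_not_singleAttached (hG : MemG 2 G) {φ : K ↪g G} (h : ¬ SingleAttached φ) :
    ∃ v ∉ Set.range φ, ∃ i j, Far K i j ∧ G.Adj v (φ i) ∧ G.Adj v (φ j) := by
  unfold SingleAttached at h
  push Not at h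
  obtain ⟨v, hv, i, j, hi, hj, hij⟩ := h
  exact ⟨v, hv, i, j, hG.far hv hij hi hj, hi, hj⟩

/-- Adding one vertex to an induced subgraph. -/
theorem nonempty_embedding_snoc {K' : SimpleGraph (Fin (n + 1))} (φ : K ↪g G) {d : V}
    (hd : d ∉ Set.range φ) {τ : Fin n → Fin n} (hτ : Function.Injective τ)
    (h1 : ∀ i j, K'.Adj (Fin.castSucc i) (Fin.castSucc j) ↔ K.Adj (τ i) (τ j))
    (h2 : ∀ i, K'.Adj (Fin.last n) (Fin.castSucc i) ↔ G.Adj d (φ (τ i))) :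
    Nonempty (K' ↪g G) := by
  refine ⟨⟨⟨Fin.snoc (α := fun _ => V) (fun i => φ (τ i)) d, ?_⟩, ?_⟩⟩
  · intro a b
    refine Fin.lastCases ?_ (fun i => ?_) a <;> refine Fin.lastCases ?_ (fun j => ?_) b
    · simp
    · intro h
      simp only [Fin.snoc_last, Fin.snoc_castSucc] at h
      exact absurd ⟨_, h.symm⟩ hd
    · intro h
      simp only [Fin.snoc_last, Fin.snoc_castSucc] at h
      exact absurd ⟨_, h⟩ hd
    · intro h
      simp only [Fin.snoc_castSucc] at h
      rw [hτ (φ.injective h)]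
  · intro a b
    change G.Adj (Fin.snoc (α := fun _ => V) (fun i => φ (τ i)) d a)
      (Fin.snoc (α := fun _ => V) (fun i => φ (τ i)) d b) ↔ _
    refine Fin.lastCases ?_ (fun i => ?_) a <;> refine Fin.lastCases ?_ (fun j => ?_) b
    · simp
    · simpa using (h2 j).symm
    · rw [SimpleGraph.adj_comm K', G.adj_comm]
      simpa using (h2 i).symm
    · simpa only [Fin.snoc_castSucc, h1] using φ.map_rel_iff

theorem finPetersen_surjective (hG : MemG 2 G) (hconn : IsKConnected 3 G)
    (φ : finPetersen ↪g G) : Function.Surjective φ := by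
  have hφ : SingleAttached φ := by
    by_contra h
    obtain ⟨v, -, i, j, hf, -⟩ := exists_far_of_not_singleAttached hG h
    have : ∀ i j, ¬ Far finPetersen i j := by decide +kernel
    exact this i j hf
  refine surjective_of_detours hG hconn hφ (R := finPetersen) (by omega) ?_ (by decide +kernel)
  decide +kernel

/-- The vertex closes the path of length five into a hole of length seven; it misses the interior
since its neighbours are pairwise far apart. -/
theorem not_seven_hole_of_far (hG : MemG 2 G) {φ : K ↪g G} {v : V} (hv : v ∉ Set.range φ)
    {i j : Fin n} (hij : i ≠ j) (hi : G.Adj v (φ i)) (hj : G.Adj v (φ j)) {g : ℕ → Fin n}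
    (hg : IsIndPath K g 5) (hg0 : g 0 = i) (hg5 : g 5 = j)
    (hfar : ∀ t, 0 < t → t < 5 → ¬ (Far K (g t) i ∧ Far K (g t) j)) : False := by
  have hf : IsIndPath G (fun t => [φ i, v, φ j].getD t v) 2 := by
    have h1 : ¬ K.Adj i j := (hG.far hv hij hi hj).2.1
    have h2 : φ i ≠ v := fun h => hv ⟨i, h⟩
    have h3 : v ≠ φ j := fun h => hv ⟨j, h.symm⟩
    refine isIndPath_of_list [φ i, v, φ j] v ?_
    intro a ha b hb hab
    simp only [List.length_cons, List.length_nil] at ha hb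
    interval_cases b <;> interval_cases a <;> simp_all [hi.symm]
  refine hG.not_odd_theta hf (hg.map φ) (by simp [hg0]) (by simp [hg5]) le_rfl (by omega) ?_
    (by decide) (by omega)
  intro a b ha0 ha hb0 hb
  obtain rfl : a = 1 := by omega
  refine ⟨fun h => hv ⟨_, h.symm⟩, fun h => hfar b hb0 hb ⟨?_, ?_⟩⟩
  · refine hG.far hv (fun he => ?_) h hi
    have := hg.inj b hb.le 0 (by omega) (he.trans hg0.symm); omega
  · refine hG.far hv (fun he => ?_) h hj
    have := hg.inj b hb.le 5 le_rfl (he.trans hg5.symm); omega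

theorem isEmpty_petersenSubEdge (hG : MemG 2 G) (hconn : IsKConnected 3 G)
    (φ : petersenSubEdge ↪g G) : False := by
  classical
  have hφ : SingleAttached φ := by
    by_contra h
    obtain ⟨v, hv, i, j, hf, hi, hj⟩ := exists_far_of_not_singleAttached hG h
    have hpath : ∀ l : List (Fin 10), l.length = 6 → (∀ a < l.length, ∀ b < l.length, a < b →
        l.getD a 0 ≠ l.getD b 0 ∧ (petersenSubEdge.Adj (l.getD a 0) (l.getD b 0) ↔ b = a + 1)) →
        (∀ t < 5, 0 < t → ¬ (Far petersenSubEdge (l.getD t 0) (l.getD 0 0) ∧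
          Far petersenSubEdge (l.getD t 0) (l.getD 5 0))) →
        G.Adj v (φ (l.getD 0 0)) → G.Adj v (φ (l.getD 5 0)) → False := by
      intro l hl h1 h2 h3 h4
      have hp := isIndPath_of_list l 0 h1
      rw [hl] at hp
      refine not_seven_hole_of_far hG hv (fun h => ?_) h3 h4 hp rfl rfl
        fun t ht0 ht5 => h2 t ht5 ht0
      have := hp.inj 0 (by omega) 5 le_rfl h
      omega
    have hcases : ∀ i j, Far petersenSubEdge i j → (i, j) ∈
        ([(8, 1), (8, 5), (9, 3), (9, 7), (8, 9), (1, 8), (5, 8), (3, 9), (7, 9), (9, 8)] :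
          List (Fin 10 × Fin 10)) := by decide +kernel
    have := hcases i j hf
    simp only [List.mem_cons, Prod.mk.injEq, List.not_mem_nil, or_false] at this
    have p1 := hpath [8, 3, 4, 5, 9, 1] rfl (by decide +kernel) (by decide +kernel)
    have p2 := hpath [8, 3, 2, 1, 9, 5] rfl (by decide +kernel) (by decide +kernel)
    have p3 := hpath [9, 1, 0, 7, 8, 3] rfl (by decide +kernel) (by decide +kernel)
    have p4 := hpath [9, 1, 2, 3, 8, 7] rfl (by decide +kernel) (by decide +kernel)
    have p5 := hpath [8, 3, 2, 6, 5, 9] rfl (by decide +kernel) (by decide +kernel)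
    rcases this with ⟨rfl, rfl⟩ | ⟨rfl, rfl⟩ | ⟨rfl, rfl⟩ | ⟨rfl, rfl⟩ | ⟨rfl, rfl⟩ |
      ⟨rfl, rfl⟩ | ⟨rfl, rfl⟩ | ⟨rfl, rfl⟩ | ⟨rfl, rfl⟩ | ⟨rfl, rfl⟩
    · exact p1 hi hj
    · exact p2 hi hj
    · exact p3 hi hj
    · exact p4 hi hj
    · exact p5 hi hj
    · exact p1 hj hi
    · exact p2 hj hi
    · exact p3 hj hi
    · exact p4 hj hi
    · exact p5 hj hi
  have hsurj := surjective_of_detours hG hconn hφ (by omega) hasDetours_petersenSubEdge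
    (by decide +kernel)
  obtain ⟨v, hv, h⟩ := hconn.exists_adj_notMem (φ 8) (T := {φ 3, φ 7})
    (Finset.card_le_two.trans_lt (by omega))
  obtain ⟨i, rfl⟩ := hsurj v
  have : ∀ i, petersenSubEdge.Adj 8 i → i = 3 ∨ i = 7 := by decide +kernel
  apply hv
  rcases this i (φ.map_rel_iff.mp h) with rfl | rfl <;> simp

theorem isEmpty_petersenSubVertex (hG : MemG 2 G) (hconn : IsKConnected 3 G)
    (hP : IsEmpty (finPetersen ↪g G)) (φ : petersenSubVertex ↪g G) : False := by
  classical
  have hφ : SingleAttached φ := by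
    by_contra h
    obtain ⟨v, hv, i, j, hf, hi, hj⟩ := exists_far_of_not_singleAttached hG h
    have hcases : ∀ i j, Far petersenSubVertex i j →
        i ∈ ([1, 5, 8] : List (Fin 9)) ∧ j ∈ ([1, 5, 8] : List (Fin 9)) ∧ i ≠ j := by
      decide +kernel
    have hmem : ∀ k, G.Adj v (φ k) → k = 1 ∨ k = 5 ∨ k = 8 := by
      intro k hk
      by_cases hki : k = i
      · have := (hcases i j hf).1
        rw [← hki] at this
        simpa using this
      · simpa using (hcases k i (hG.far hv hki hk hi)).1
    -- The missing Petersen vertex sees 1, 5, 8. A vertex seeing all three restores Petersen; one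
    -- seeing two gives Petersen minus an edge, the maps `τ` being symmetries that move the pair to
    -- 1, 5.
    have snoc := fun (N : Fin 9 → Prop) (K' : SimpleGraph (Fin 10)) τ hτ h1
      (h2 : ∀ i, K'.Adj (Fin.last 9) (Fin.castSucc i) ↔ N (τ i))
      (h3 : ∀ i, N i ↔ G.Adj v (φ i)) =>
      nonempty_embedding_snoc (K' := K') φ hv (τ := τ) hτ h1 fun i => (h2 i).trans (h3 _)
    by_cases a1 : G.Adj v (φ 1) <;> by_cases a5 : G.Adj v (φ 5) <;> by_cases a8 : G.Adj v (φ 8)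
    · exact not_isEmpty_iff.mpr (snoc (fun k => k = 1 ∨ k = 5 ∨ k = 8) finPetersen id
        Function.injective_id (by decide +kernel) (by decide +kernel)
        fun k => ⟨by rintro (rfl | rfl | rfl) <;> assumption, hmem k⟩) hP
    · obtain ⟨ψ⟩ := snoc (fun k => k = 1 ∨ k = 5) petersenSubEdge id
        Function.injective_id (by decide +kernel) (by decide +kernel)
        fun k => ⟨by rintro (rfl | rfl) <;> assumption, fun h => by
          rcases hmem k h with rfl | rfl | rfl <;>
            first | exact Or.inl rfl | exact Or.inr rfl | contradiction⟩
      exact isEmpty_petersenSubEdge hG hconn ψ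
    · obtain ⟨ψ⟩ := snoc (fun k => k = 1 ∨ k = 8) petersenSubEdge
        ![0, 1, 2, 6, 7, 8, 3, 4, 5] (by decide +kernel) (by decide +kernel) (by decide +kernel)
        fun k => ⟨by rintro (rfl | rfl) <;> assumption, fun h => by
          rcases hmem k h with rfl | rfl | rfl <;>
            first | exact Or.inl rfl | exact Or.inr rfl | contradiction⟩
      exact isEmpty_petersenSubEdge hG hconn ψ
    · have b := hmem i hi
      have c := hmem j hj
      have := hf.1
      rcases b with rfl | rfl | rfl <;> rcases c with rfl | rfl | rfl <;> contradiction
    · obtain ⟨ψ⟩ := snoc (fun k => k = 5 ∨ k = 8) petersenSubEdge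
        ![3, 8, 7, 0, 4, 5, 6, 2, 1] (by decide +kernel) (by decide +kernel) (by decide +kernel)
        fun k => ⟨by rintro (rfl | rfl) <;> assumption, fun h => by
          rcases hmem k h with rfl | rfl | rfl <;>
            first | exact Or.inl rfl | exact Or.inr rfl | contradiction⟩
      exact isEmpty_petersenSubEdge hG hconn ψ
    all_goals
      have b := hmem i hi
      have c := hmem j hj
      have := hf.1
      rcases b with rfl | rfl | rfl <;> rcases c with rfl | rfl | rfl <;> contradiction
  have hsurj := surjective_of_detours hG hconn hφ (R := petersenSubVertex) (by omega)
    (by decide +kernel) (by decide +kernel)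
  obtain ⟨v, hv, h⟩ := hconn.exists_adj_notMem (φ 8) (T := {φ 3, φ 7})
    (Finset.card_le_two.trans_lt (by omega))
  obtain ⟨i, rfl⟩ := hsurj v
  have : ∀ i, petersenSubVertex.Adj 8 i → i = 3 ∨ i = 7 := by decide +kernel
  apply hv
  rcases this i (φ.map_rel_iff.mp h) with rfl | rfl <;> simp

theorem singleAttached_octagon (hG : MemG 2 G)
    (hP : IsEmpty (petersenSubVertex ↪g G)) (φ : octagon ↪g G) : SingleAttached φ := by
  by_contra h
  obtain ⟨v, hv, i, j, hf, hi, hj⟩ := exists_far_of_not_singleAttached hG h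
  have hcases : ∀ i j, Far octagon i j → (i, j) = (1, 5) ∨ (i, j) = (5, 1) ∨ (i, j) = (3, 7) ∨
      (i, j) = (7, 3) := by decide +kernel
  have hmem : ∀ k, G.Adj v (φ k) → k = i ∨ k = j := by
    intro k hk
    by_contra! hne
    have h1 := hcases _ _ (hG.far hv hne.1 hk hi)
    have h2 := hcases _ _ (hG.far hv hne.2 hk hj)
    have := hf.1
    simp only [Prod.mk.injEq] at h1 h2
    omega
  have hN : ∀ k, (k = i ∨ k = j) ↔ G.Adj v (φ k) :=
    fun k => ⟨by rintro (rfl | rfl) <;> assumption, hmem k⟩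
  refine not_isEmpty_iff.mpr ?_ hP
  have := hcases i j hf
  simp only [Prod.mk.injEq] at this
  rcases this with ⟨rfl, rfl⟩ | ⟨rfl, rfl⟩ | ⟨rfl, rfl⟩ | ⟨rfl, rfl⟩
  -- Rotation carries the pair 3, 7 seen by the new vertex to 5, 1.
  · refine nonempty_embedding_snoc φ hv (τ := fun i => i + 2) (add_left_injective 2)
      (by decide +kernel) fun k => (Iff.trans ?_ (hN _))
    revert k; decide +kernel
  · refine nonempty_embedding_snoc φ hv (τ := fun i => i + 2) (add_left_injective 2)
      (by decide +kernel) fun k => (Iff.trans ?_ (hN _))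
    revert k; decide +kernel
  · refine nonempty_embedding_snoc φ hv (τ := id) Function.injective_id
      (by decide +kernel) fun k => (Iff.trans ?_ (hN _))
    revert k; decide +kernel
  · refine nonempty_embedding_snoc φ hv (τ := id) Function.injective_id
      (by decide +kernel) fun k => (Iff.trans ?_ (hN _))
    revert k; decide +kernel

/-! ### Identification with the given Petersen graph and θ⁺. -/

instance : DecidableRel petersenAdj
  | Sum.inl i, Sum.inl j => inferInstanceAs (Decidable (j = i + 1 ∨ i = j + 1))
  | Sum.inr i, Sum.inr j => inferInstanceAs (Decidable (j = i + 2 ∨ i = j + 2))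
  | Sum.inl i, Sum.inr j => inferInstanceAs (Decidable (i = j))
  | Sum.inr i, Sum.inl j => inferInstanceAs (Decidable (i = j))

/-- The labelling of the Petersen graph used by `finPetersen`. -/
def petersenLabel : Fin 10 → ZMod 5 ⊕ ZMod 5 :=
  ![Sum.inl 3, Sum.inl 2, Sum.inr 2, Sum.inr 0, Sum.inr 3, Sum.inr 1, Sum.inr 4, Sum.inl 4,
    Sum.inl 0, Sum.inl 1]

theorem petersenLabel_bijective : Function.Bijective petersenLabel := by
  constructor <;> decide +kernel

theorem petersenAdj_petersenLabel : ∀ i j, petersenAdj (petersenLabel i) (petersenLabel j) ↔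
    finPetersen.Adj i j := by
  decide +kernel

/-- The Petersen graph is `finPetersen`. -/
noncomputable def finPetersenIso : finPetersen ≃g petersen where
  toEquiv := Equiv.ofBijective petersenLabel petersenLabel_bijective
  map_rel_iff' := petersenAdj_petersenLabel _ _

/-- The graph `θ⁺` is `octagon`. -/
def octagonEmbedding : octagon ↪g thetaPlus where
  -- Labels 8 and 9 are the deleted vertices, so labels below 8 avoid them.
  toFun i := ⟨petersenLabel (Fin.castLE (by omega) i), by
    have : ∀ i : Fin 8, ¬ (petersenLabel (Fin.castLE (by omega) i) = Sum.inl 0 ∨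
      petersenLabel (Fin.castLE (by omega) i) = Sum.inl 1) := by decide +kernel
    exact this i⟩
  inj' i j h := Fin.castLE_injective (show 8 ≤ 10 by omega) (petersenLabel_bijective.1 (congrArg Subtype.val h))
  map_rel_iff' := by
    intro i j
    have h : ∀ i j : Fin 8, finPetersen.Adj (Fin.castLE (by omega) i) (Fin.castLE (by omega) j) ↔
        octagon.Adj i j := by decide +kernel
    exact Iff.trans (petersenAdj_petersenLabel (Fin.castLE (by omega) i) (Fin.castLE (by omega) j))
      (h i j)

end OddHoles

theorem mainTheorem5 {V : Type*} [Finite V] (G : SimpleGraph V)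
    (hG : OddHoles.MemG 2 G)
    (hconn : OddHoles.IsKConnected 3 G)
    (hcut : ∀ S : Finset V, S.card = 3 → OddHoles.IsCutset G S → G.IsIndepSet (S : Set V))
    (hne : IsEmpty (G ≃g OddHoles.petersen)) :
    ¬ OddHoles.thetaPlus.IsIndContained G := by
  rintro ⟨ψ⟩
  have h1 : IsEmpty (OddHoles.finPetersen ↪g G) := by
    refine ⟨fun φ => hne.false ?_⟩
    have e : OddHoles.finPetersen ≃g G :=
      { toEquiv := Equiv.ofBijective φ
          ⟨φ.injective, OddHoles.finPetersen_surjective hG hconn φ⟩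
        map_rel_iff' := φ.map_rel_iff }
    exact e.symm.trans OddHoles.finPetersenIso
  have h2 : IsEmpty (OddHoles.petersenSubVertex ↪g G) :=
    ⟨OddHoles.isEmpty_petersenSubVertex hG hconn h1⟩
  have φ : OddHoles.octagon ↪g G := ψ.comp OddHoles.octagonEmbedding
  exact OddHoles.not_singleAttached_octagon hG hconn hcut φ
    (OddHoles.singleAttached_octagon hG h2 φ)
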